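/- Let $\&$ be a continuous t-norm on $[0,1]$, i.e. a continuous binary operation making $([0,1],\&,1)$ a commutative unital quantale, with implication determined by $p\,\&\,q\le r\iff q\le p\to r$. **$[0,1]$-orders.** A $[0,1]$-ordered set is a set $X$ with a map $X(-,-)\colon X\times X\to[0,1]$ such that $X(x,x)=1$ and $X(y,z)\,\&\,X(x,y)\le X(x,z)$; it is separated if $X(x,y)=X(y,x)=1$ implies $x=y$. Let $\alpha_R(x,y)=y\to x$ on $[0,1]$; the power $([0,1],\alpha_R)^I$ carries the order $\bigwedge_{i}\alpha_R(x_i,y_i)$. A weight of $X$ is a map $\phi\colon X\to[0,1]$ with $\phi(y)\,\&\,X(x,y)\le\phi(x)$. Put $\mathrm{sub}_X(\phi,\psi)=\bigwedge_{x}(\phi(x)\to\psi(x))$. An element $a$ is a supremum of a weight $\phi$ if $X(a,y)=\mathrm{sub}_X(\phi,X(-,y))$ for all $y\in X$. A weight is forward Cauchy if it equals $\bigvee_i\bigwedge_{j\ge i}X(-,x_j)$ for a net $(x_i)$ with $\bigvee_i\bigwedge_{i\le j\le l}X(x_j,x_l)=1$. A map $f\colon X\to Y$ of $[0,1]$-ordered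 sets is $[0,1]$-Scott continuous if $X(x,y)\le Y(f(x),f(y))$ for all $x,y$ and, whenever $a$ is a supremum of a forward Cauchy weight $\phi$ of $X$, $f(a)$ is a supremum of the weight $f^{\to}(\phi)(y)=\bigvee_{x}\phi(x)\,\&\,Y(y,f(x))$ of $Y$. **$[0,1]$-approach spaces.** A $[0,1]$-approach space is a set $X$ with a map $\delta\colon X\times 2^X\to[0,1]$ such that $\delta(x,\{x\})=1$, $\delta(x,\varnothing)=0$, $\delta(x,A\cup B)=\delta(x,A)\vee\delta(x,B)$ and $\delta(x,A)\ge\big(\bigwedge_{b\in B}\delta(b,A)\big)\,\&\,\delta(x,B)$. A map $f$ is continuous if $\delta_X(x,A)\le\delta_Y(f(x),f(A))$ for all $x$ and $A$; subspaces carry the restriction of $\delta$. The space $Z$ is injective if every continuous map to $Z$ from a subspace of a $[0,1]$-approach space $X$ extends to a continuous map $X\to Z$. The specialization $[0,1]$-order $\Omega(X)$ is given by $\Omega(X)(x,y)=\delta(x,\{y\})$, and $X$ is separated if $\Omega(X)$ is separated. For a $[0,1]$-ordered set $X$, a weight is Scott closed if it is $[0,1]$-Scott continuous as a map $X\to([0,1],\alpha_R)$,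 and $\Sigma X$ is the set $X$ with the Scott $[0,1]$-approach structure $$\delta(x,A)=\bigwedge\{\phi(x)\mid \phi \text{ is a Scott closed weight of } X \text{ with } \phi(a)=1 \text{ for all } a\in A\}.$$ **Statement.** Let $X$ be a separated $[0,1]$-approach space. Then $X$ is injective if and only if both of the following conditions hold: 1. $\Omega(X)$ is a retract of some power $([0,1],\alpha_R)^I$ in the category of $[0,1]$-ordered sets and $[0,1]$-Scott continuous maps; 2. $X=\Sigma\Omega(X)$. -/

import Mathlib

universe u v w

noncomputable section

open unitInterval

/-- A continuous t-norm: a continuous binary operation on `[0,1]` making `([0,1], op, 1)` a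
(commutative, unital) quantale. -/
structure ContinuousTNorm where
  op : I → I → I
  op_assoc : ∀ a b c, op (op a b) c = op a (op b c)
  op_comm : ∀ a b, op a b = op b a
  one_op : ∀ a, op 1 a = a
  op_sSup : ∀ (a : I) (S : Set I), op a (sSup S) = ⨆ b ∈ S, op a b
  continuous_op : Continuous fun p : I × I => op p.1 p.2

namespace ContinuousTNorm

variable (T : ContinuousTNorm)

/-- The implication operator: the largest `q` with `op p q ≤ r`. -/
def imp (p r : I) : I := sSup {q | T.op p q ≤ r}

theorem op_one (a : I) : T.op a 1 = a := by rw [T.op_comm, T.one_op]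

theorem op_mono_right (a : I) {b c : I} (h : b ≤ c) : T.op a b ≤ T.op a c := by
  have h1 := T.op_sSup a {b, c}
  rw [sSup_pair, sup_eq_right.2 h] at h1
  rw [h1]
  exact le_iSup₂ (f := fun x (_ : x ∈ ({b, c} : Set I)) => T.op a x) b (by simp)

theorem op_mono {a b c d : I} (h : a ≤ c) (h' : b ≤ d) : T.op a b ≤ T.op c d := by
  refine (T.op_mono_right a h').trans ?_
  rw [T.op_comm a d, T.op_comm c d]
  exact T.op_mono_right d h

theorem le_imp {p q r : I} : q ≤ T.imp p r ↔ T.op p q ≤ r := by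
  constructor
  · intro h
    refine (T.op_mono_right p h).trans ?_
    rw [imp, T.op_sSup]
    exact iSup₂_le fun b hb => hb
  · intro h
    exact le_sSup h

theorem op_imp_le (p r : I) : T.op p (T.imp p r) ≤ r := T.le_imp.1 le_rfl

theorem op_le_left (a b : I) : T.op a b ≤ a := by
  simpa [T.op_one] using T.op_mono_right a (show b ≤ 1 from b.2.2)

theorem one_le_imp {p r : I} : 1 ≤ T.imp p r ↔ p ≤ r := by rw [T.le_imp, T.op_one]

theorem imp_mono {p p' r r' : I} (h : p' ≤ p) (h' : r ≤ r') : T.imp p r ≤ T.imp p' r' := by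
  rw [T.le_imp]
  exact (T.op_mono h le_rfl).trans ((T.op_imp_le p r).trans h')

theorem imp_imp (p q r : I) : T.imp p (T.imp q r) = T.imp q (T.imp p r) := by
  refine eq_of_forall_le_iff fun c => ?_
  rw [T.le_imp, T.le_imp, T.le_imp, T.le_imp, ← T.op_assoc, ← T.op_assoc, T.op_comm p q]

theorem imp_comp (p q r : I) : T.op (T.imp q r) (T.imp p q) ≤ T.imp p r := by
  rw [T.le_imp, T.op_comm (T.imp q r), ← T.op_assoc]
  exact (T.op_mono (T.op_imp_le p q) le_rfl).trans (T.op_imp_le q r)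

end ContinuousTNorm

/-! ### `[0,1]`-ordered sets -/

/-- A `[0,1]`-order on `X`, with `α.hom x y` the value `X(x,y)`. -/
@[ext]
structure QOrder (T : ContinuousTNorm) (X : Type u) where
  hom : X → X → I
  one_le_hom : ∀ x, 1 ≤ hom x x
  hom_trans : ∀ x y z, T.op (hom y z) (hom x y) ≤ hom x z

namespace QOrder

variable {T : ContinuousTNorm} {X : Type u} {Y : Type v}

/-- Isomorphic elements are identical. -/
def IsSeparated (α : QOrder T X) : Prop :=
  ∀ x y, 1 ≤ α.hom x y ⊓ α.hom y x → x = y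

/-- The `[0,1]`-ordered set `([0,1], α_R)`, with `α_R(x,y) = y → x`. -/
def alphaR (T : ContinuousTNorm) : QOrder T I where
  hom x y := T.imp y x
  one_le_hom _ := T.one_le_imp.2 le_rfl
  hom_trans x y z := by
    rw [T.op_comm]
    exact T.imp_comp z y x

/-- The power `X^ι` in the category of `[0,1]`-ordered sets. -/
def power (α : QOrder T X) (ι : Type v) : QOrder T (ι → X) where
  hom x y := ⨅ i, α.hom (x i) (y i)
  one_le_hom x := le_iInf fun i => α.one_le_hom (x i)
  hom_trans x y z := le_iInf fun i =>
    (T.op_mono (iInf_le _ i) (iInf_le _ i)).trans (α.hom_trans (x i) (y i) (z i))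

/-- `f` preserves `[0,1]`-order. -/
def IsOrderPreserving (α : QOrder T X) (β : QOrder T Y) (f : X → Y) : Prop :=
  ∀ x y, α.hom x y ≤ β.hom (f x) (f y)

/-- `φ` is a weight (lower fuzzy set). -/
def IsWeight (α : QOrder T X) (φ : X → I) : Prop :=
  ∀ x y, T.op (φ y) (α.hom x y) ≤ φ x

/-- The fuzzy inclusion order `sub_X(φ,ψ)`. -/
def sub (T : ContinuousTNorm) {X : Type u} (φ ψ : X → I) : I := ⨅ x, T.imp (φ x) (ψ x)

/-- `a` is a supremum of `φ`: `X(a,y) = sub_X(φ, X(-,y))` for all `y`. -/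
def IsSup (α : QOrder T X) (φ : X → I) (a : X) : Prop :=
  ∀ y, α.hom a y = sub T φ (fun x => α.hom x y)

/-- The image `f^→(φ)` of a weight `φ` along `f`. -/
def image (β : QOrder T Y) (f : X → Y) (φ : X → I) : Y → I :=
  fun y => ⨆ x, T.op (φ x) (β.hom y (f x))

/-- A net `x` in `X` is forward Cauchy. -/
def IsForwardCauchyNet (α : QOrder T X) {J : Type w} [Preorder J] (x : J → X) : Prop :=
  ⨆ i, ⨅ (j) (l) (_ : i ≤ j) (_ : j ≤ l), α.hom (x j) (x l) = 1

/-- A weight is forward Cauchy if it is `⨆ i, ⨅ j ≥ i, X(-, x j)` for some forward Cauchy net `x`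
(indexed by a nonempty directed preordered set). -/
def IsForwardCauchyWeight (α : QOrder T X) (φ : X → I) : Prop :=
  α.IsWeight φ ∧ ∃ (J : Type u) (_ : Preorder J) (_ : IsDirected J (· ≤ ·)) (_ : Nonempty J)
    (x : J → X), α.IsForwardCauchyNet x ∧
      ∀ y, φ y = ⨆ i, ⨅ (j) (_ : i ≤ j), α.hom y (x j)

/-- `f` is `[0,1]`-Scott continuous: it preserves `[0,1]`-order and all existing suprema of forward
Cauchy weights. -/
def IsScottContinuous (α : QOrder T X) (β : QOrder T Y) (f : X → Y) : Prop :=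
  α.IsOrderPreserving β f ∧
    ∀ φ, α.IsForwardCauchyWeight φ → ∀ a, α.IsSup φ a → β.IsSup (β.image f φ) (f a)

/-- `X` is a retract of `Y` in the category of `[0,1]`-ordered sets and `[0,1]`-Scott continuous
maps. -/
def IsScottRetract (α : QOrder T X) (β : QOrder T Y) : Prop :=
  ∃ (s : X → Y) (r : Y → X),
    α.IsScottContinuous β s ∧ β.IsScottContinuous α r ∧ ∀ x, r (s x) = x

/-- `φ` is a Scott closed weight: it is `[0,1]`-Scott continuous as a map to `([0,1], α_R)`
(the order preserving maps to `([0,1], α_R)` being precisely the weights). -/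
def IsScottClosed (α : QOrder T X) (φ : X → I) : Prop :=
  α.IsScottContinuous (alphaR T) φ

end QOrder

/-! ### `[0,1]`-approach spaces -/

/-- A `[0,1]`-approach structure on `X`. -/
@[ext]
structure ApproachStructure (T : ContinuousTNorm) (X : Type u) where
  dist : X → Set X → I
  one_le_dist : ∀ x, 1 ≤ dist x {x}
  dist_empty : ∀ x, dist x ∅ = 0
  dist_union : ∀ x A B, dist x (A ∪ B) = dist x A ⊔ dist x B
  le_dist : ∀ x A B, T.op (⨅ b ∈ B, dist b A) (dist x B) ≤ dist x A

namespace ApproachStructure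

variable {T : ContinuousTNorm} {X : Type u} {Y : Type v}

/-- Continuous maps of `[0,1]`-approach spaces. -/
def IsContinuous (δ : ApproachStructure T X) (ε : ApproachStructure T Y) (f : X → Y) : Prop :=
  ∀ x A, δ.dist x A ≤ ε.dist (f x) (f '' A)

/-- The subspace of `(X, δ)` on a subset `S`. -/
def subspace (δ : ApproachStructure T X) (S : Set X) : ApproachStructure T S where
  dist x A := δ.dist x (Subtype.val '' A)
  one_le_dist x := by simpa using δ.one_le_dist x
  dist_empty x := by simpa using δ.dist_empty x
  dist_union x A B := by rw [Set.image_union, δ.dist_union]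
  le_dist x A B := by
    have h := δ.le_dist x (Subtype.val '' A) (Subtype.val '' B)
    rwa [iInf_image] at h

/-- The specialization `[0,1]`-order `Ω(δ)(x,y) = δ(x,{y})`. -/
def specialization (δ : ApproachStructure T X) : QOrder T X where
  hom x y := δ.dist x {y}
  one_le_hom := δ.one_le_dist
  hom_trans x y z := by
    have h := δ.le_dist x {z} {y}
    rwa [iInf_singleton] at h

/-- A `[0,1]`-approach space is separated if its specialization `[0,1]`-order is. -/
def IsSeparated (δ : ApproachStructure T X) : Prop := δ.specialization.IsSeparated

/-- `(Z, ε)` is injective: every continuous map from a subspace of a `[0,1]`-approach space `X` to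
`Z` extends continuously to `X`. -/
def IsInjective {Z : Type u} (ε : ApproachStructure T Z) : Prop :=
  ∀ (X : Type u) (δ : ApproachStructure T X) (S : Set X) (f : S → Z),
    (δ.subspace S).IsContinuous ε f →
      ∃ g : X → Z, δ.IsContinuous ε g ∧ ∀ y : S, g y = f y

end ApproachStructure

/-! ### `[0,1]`-cotopological spaces -/

/-- A `[0,1]`-cotopology on `X`; the elements of `closed` are the closed sets. -/
structure Cotopology (T : ContinuousTNorm) (X : Type u) where
  closed : Set (X → I)
  zero_mem : (fun _ => 0) ∈ closed
  sup_mem : ∀ φ ∈ closed, ∀ ψ ∈ closed, φ ⊔ ψ ∈ closed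
  sInf_mem : ∀ S, S ⊆ closed → sInf S ∈ closed
  imp_mem : ∀ (p : I), ∀ φ ∈ closed, (fun x => T.imp p (φ x)) ∈ closed

namespace Cotopology

variable {T : ContinuousTNorm} {X : Type u}

/-- The closure of a fuzzy set: the meet of all closed sets above it. -/
def closure (τ : Cotopology T X) (μ : X → I) : X → I := sInf {φ | φ ∈ τ.closed ∧ μ ≤ φ}

/-- The fuzzy set `1_A`. -/
def one (A : Set X) : X → I := A.indicator fun _ => 1

theorem one_le_iff {A : Set X} {φ : X → I} : one A ≤ φ ↔ ∀ a ∈ A, 1 ≤ φ a := by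
  classical
  constructor
  · intro h a ha
    have := h a
    rwa [one, Set.indicator_of_mem ha] at this
  · intro h a
    by_cases ha : a ∈ A
    · rw [one, Set.indicator_of_mem ha]
      exact h a ha
    · rw [one, Set.indicator_of_notMem ha]
      exact (φ a).2.1

theorem closure_mem (τ : Cotopology T X) (μ : X → I) : τ.closure μ ∈ τ.closed :=
  τ.sInf_mem _ fun _ h => h.1

theorem le_closure (τ : Cotopology T X) (μ : X → I) : μ ≤ τ.closure μ :=
  le_sInf fun _ h => h.2

theorem closure_le (τ : Cotopology T X) {μ φ : X → I} (hφ : φ ∈ τ.closed) (h : μ ≤ φ) :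
    τ.closure μ ≤ φ := sInf_le ⟨hφ, h⟩

/-- The `[0,1]`-approach structure `ζ(τ)(x,A)`, the value at `x` of the closure of `1_A`. -/
def zeta (τ : Cotopology T X) : ApproachStructure T X where
  dist x A := τ.closure (one A) x
  one_le_dist x := one_le_iff.1 (τ.le_closure (one {x})) x rfl
  dist_empty x := by
    refine le_antisymm (τ.closure_le τ.zero_mem ?_ x) (τ.closure (one ∅) x).2.1
    exact one_le_iff.2 fun a ha => ha.elim
  dist_union x A B := by
    refine le_antisymm ?_ (sup_le ?_ ?_)
    · refine τ.closure_le (τ.sup_mem _ (τ.closure_mem (one A)) _ (τ.closure_mem (one B))) ?_ x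
      refine one_le_iff.2 fun a ha => ?_
      rcases ha with ha | ha
      · exact le_sup_of_le_left (one_le_iff.1 (τ.le_closure (one A)) a ha)
      · exact le_sup_of_le_right (one_le_iff.1 (τ.le_closure (one B)) a ha)
    · refine τ.closure_le (τ.closure_mem _) (one_le_iff.2 fun a ha => ?_) x
      exact one_le_iff.1 (τ.le_closure (one (A ∪ B))) a (Or.inl ha)
    · refine τ.closure_le (τ.closure_mem _) (one_le_iff.2 fun a ha => ?_) x
      exact one_le_iff.1 (τ.le_closure (one (A ∪ B))) a (Or.inr ha)
  le_dist x A B := by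
    rw [← T.le_imp]
    refine τ.closure_le (τ.imp_mem _ _ (τ.closure_mem (one A))) (one_le_iff.2 fun b hb => ?_) x
    exact T.one_le_imp.2 (iInf₂_le b hb)

end Cotopology

/-! ### The Scott cotopology and the Scott approach structure -/

namespace QOrder

variable {T : ContinuousTNorm} {X : Type u} {Y : Type v}

theorem le_sub {c : I} {φ ψ : X → I} : c ≤ sub T φ ψ ↔ ∀ x, T.op (φ x) c ≤ ψ x := by
  simp only [sub, le_iInf_iff, T.le_imp]

theorem isOrderPreserving_alphaR {α : QOrder T X} {φ : X → I} :
    α.IsOrderPreserving (alphaR T) φ ↔ α.IsWeight φ :=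
  forall₂_congr fun _ _ => T.le_imp

theorem sub_image {β : QOrder T Y} (f : X → Y) (φ : X → I) (t : Y) :
    sub T (β.image f φ) (fun y => β.hom y t) = sub T φ (fun x => β.hom (f x) t) := by
  refine eq_of_forall_le_iff fun c => ?_
  rw [le_sub, le_sub]
  constructor
  · intro h x
    refine le_trans (T.op_mono ?_ le_rfl) (h (f x))
    refine le_trans ?_ (le_iSup _ x)
    conv_lhs => rw [← T.op_one (φ x)]
    exact T.op_mono le_rfl (β.one_le_hom _)
  · intro h y
    rw [T.op_comm, ← T.le_imp]
    refine iSup_le fun x => ?_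
    rw [T.le_imp, T.op_comm, T.op_comm (φ x), T.op_assoc, T.op_comm]
    exact (T.op_mono (h x) le_rfl).trans (β.hom_trans y (f x) t)

/-- A supremum in `([0,1], α_R)` of the image of `λ` along `φ` is `sub_X(λ, φ)`. -/
theorem isSup_alphaR {φ l : X → I} {b : I} :
    (alphaR T).IsSup ((alphaR T).image φ l) b ↔ b = sub T l φ := by
  have key : ∀ t, sub T ((alphaR T).image φ l) (fun y => (alphaR T).hom y t)
      = T.imp t (sub T l φ) := by
    intro t
    rw [sub_image]
    refine eq_of_forall_le_iff fun c => ?_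
    rw [le_sub, T.le_imp, le_sub]
    refine forall_congr' fun x => ?_
    change _ ≤ T.imp t (φ x) ↔ _
    rw [T.le_imp, ← T.op_assoc, ← T.op_assoc, T.op_comm t]
  constructor
  · intro h
    have h1 := fun t => (h t).trans (key t)
    refine eq_of_forall_le_iff fun c => ?_
    rw [← T.one_le_imp (p := c) (r := sub T l φ), ← h1 c]
    exact T.one_le_imp.symm
  · rintro rfl t
    exact (key t).symm

theorem isScottClosed_iff {α : QOrder T X} {φ : X → I} :
    α.IsScottClosed φ ↔ α.IsWeight φ ∧
      ∀ l, α.IsForwardCauchyWeight l → ∀ a, α.IsSup l a → φ a = sub T l φ :=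
  and_congr isOrderPreserving_alphaR
    (forall_congr' fun _ => imp_congr_right fun _ => forall₂_congr fun _ _ => isSup_alphaR)

theorem IsForwardCauchyWeight.sub_sup_le {α : QOrder T X} {l : X → I}
    (h : α.IsForwardCauchyWeight l) {φ ψ : X → I} (hφ : α.IsWeight φ) (hψ : α.IsWeight ψ) :
    sub T l (φ ⊔ ψ) ≤ sub T l φ ⊔ sub T l ψ := by
  obtain ⟨-, J, _, _, _, x, hx, hl⟩ := h
  set r := sub T l (φ ⊔ ψ) with hr
  have main : ∀ (c : I) (χ : X → I), α.IsWeight χ → (∀ k, ∃ j, k ≤ j ∧ c ≤ χ (x j)) →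
      c ≤ sub T l χ := by
    intro c χ hχ hc
    refine le_sub.2 fun y => ?_
    rw [T.op_comm, ← T.le_imp, hl]
    refine iSup_le fun k => ?_
    obtain ⟨j, hkj, hj⟩ := hc k
    refine (iInf₂_le j hkj).trans (T.le_imp.2 ?_)
    exact (T.op_mono hj le_rfl).trans (hχ y (x j))
  have step : ∀ i, (⨅ (j) (m) (_ : i ≤ j) (_ : j ≤ m), α.hom (x j) (x m)) ≤
      T.imp r (sub T l φ ⊔ sub T l ψ) := by
    intro i
    set c := ⨅ (j) (m) (_ : i ≤ j) (_ : j ≤ m), α.hom (x j) (x m) with hc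
    rw [T.le_imp]
    have hcj : ∀ j, i ≤ j → c ≤ l (x j) := by
      intro j hij
      rw [hl]
      refine le_trans ?_ (le_iSup _ j)
      refine le_iInf₂ fun m hjm => ?_
      exact (iInf₂_le j m).trans (iInf₂_le hij hjm)
    have hor : ∀ j, i ≤ j → T.op r c ≤ φ (x j) ∨ T.op r c ≤ ψ (x j) := by
      intro j hij
      rw [← le_sup_iff, T.op_comm]
      exact (T.op_mono (hcj j hij) le_rfl).trans (le_sub.1 hr.le (x j))
    by_cases hcof : ∀ k, ∃ j, k ≤ j ∧ T.op r c ≤ φ (x j)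
    · exact le_sup_of_le_left (main _ φ hφ hcof)
    · push Not at hcof
      obtain ⟨k₀, hk₀⟩ := hcof
      refine le_sup_of_le_right (main _ ψ hψ fun k => ?_)
      obtain ⟨m, hkm, hk₀m⟩ := exists_ge_ge k k₀
      obtain ⟨j, hmj, hij⟩ := exists_ge_ge m i
      exact ⟨j, hkm.trans hmj, (hor j hij).resolve_left (hk₀ j (hk₀m.trans hmj)).not_ge⟩
  rw [← T.one_le_imp, ← hx]
  exact iSup_le step

theorem IsForwardCauchyWeight.sub_zero {α : QOrder T X} {l : X → I}
    (h : α.IsForwardCauchyWeight l) : sub T l (fun _ => 0) = 0 := by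
  obtain ⟨-, J, _, _, _, x, hx, hl⟩ := h
  refine le_antisymm ?_ (sub T l fun _ => 0).2.1
  rw [← T.one_le_imp, ← hx]
  refine iSup_le fun i => T.le_imp.2 ?_
  refine le_trans ?_ (le_sub.1 (le_refl (sub T l fun _ => 0)) (x i))
  rw [T.op_comm]
  refine T.op_mono ?_ le_rfl
  rw [hl]
  refine le_trans ?_ (le_iSup _ i)
  exact le_iInf₂ fun j hij => (iInf₂_le i j).trans (iInf₂_le le_rfl hij)

theorem sub_mono {l φ ψ : X → I} (h : φ ≤ ψ) : sub T l φ ≤ sub T l ψ :=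
  iInf_mono fun x => T.imp_mono le_rfl (h x)

/-- The Scott `[0,1]`-cotopology: the closed sets are the Scott closed weights. -/
def scottCotopology (α : QOrder T X) : Cotopology T X where
  closed := {φ | α.IsScottClosed φ}
  zero_mem := isScottClosed_iff.2
    ⟨fun _ _ => T.op_le_left _ _, fun _ hl _ _ => hl.sub_zero.symm⟩
  sup_mem := by
    intro φ hφ ψ hψ
    obtain ⟨hφ, hφ'⟩ := isScottClosed_iff.1 hφ
    obtain ⟨hψ, hψ'⟩ := isScottClosed_iff.1 hψ
    refine isScottClosed_iff.2 ⟨fun x y => ?_, fun l hl a ha => ?_⟩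
    · change T.op (φ y ⊔ ψ y) _ ≤ φ x ⊔ ψ x
      rcases le_total (φ y) (ψ y) with h | h
      · rw [sup_eq_right.2 h]
        exact le_sup_of_le_right (hψ x y)
      · rw [sup_eq_left.2 h]
        exact le_sup_of_le_left (hφ x y)
    · change φ a ⊔ ψ a = _
      rw [hφ' l hl a ha, hψ' l hl a ha]
      exact le_antisymm (sup_le (sub_mono le_sup_left) (sub_mono le_sup_right))
        (hl.sub_sup_le hφ hψ)
  sInf_mem := by
    intro S hS
    have hS' := fun φ hφ => isScottClosed_iff.1 (hS (a := φ) hφ)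
    refine isScottClosed_iff.2 ⟨fun x y => ?_, fun l hl a ha => ?_⟩
    · rw [sInf_apply, sInf_apply]
      refine le_iInf fun φ => ?_
      exact (T.op_mono (iInf_le _ φ) le_rfl).trans ((hS' φ.1 φ.2).1 x y)
    · refine eq_of_forall_le_iff fun c => ?_
      rw [sInf_apply, le_iInf_iff, le_sub]
      simp only [sInf_apply, le_iInf_iff]
      constructor
      · intro h x φ
        have := h φ
        rw [(hS' φ.1 φ.2).2 l hl a ha] at this
        exact le_sub.1 this x
      · intro h φ
        rw [(hS' φ.1 φ.2).2 l hl a ha]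
        exact le_sub.2 fun x => h x φ
  imp_mem := by
    intro p φ hφ
    obtain ⟨hφ, hφ'⟩ := isScottClosed_iff.1 hφ
    refine isScottClosed_iff.2 ⟨fun x y => ?_, fun l hl a ha => ?_⟩
    · rw [T.le_imp, ← T.op_assoc]
      exact (T.op_mono (T.op_imp_le p _) le_rfl).trans (hφ x y)
    · refine eq_of_forall_le_iff fun c => ?_
      rw [hφ' l hl a ha, T.le_imp, le_sub, le_sub]
      refine forall_congr' fun x => ?_
      rw [T.le_imp, ← T.op_assoc, ← T.op_assoc, T.op_comm p]

/-- The `[0,1]`-approach space `ΣX`: the Scott `[0,1]`-approach structure `ζ(σ(α))`. -/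
def scottApproach (α : QOrder T X) : ApproachStructure T X := α.scottCotopology.zeta

end QOrder

end

noncomputable section
open unitInterval Filter Topology

/-! ### Forward Cauchy nets and the weights they define. -/

namespace QOrder

variable {T : ContinuousTNorm} {X : Type u} {Y : Type v}

/-! The interval with distance `⨅ A → x` plays the role of the Sierpinski space: continuous maps
into it are the closed functions `IsClosedFun`, and the functions `δ.dist · A` already determine the
structure.

Two facts carry the theorem. First, closed functions extend from subspaces
(`IsClosedFun.exists_extension`); this uses uniform continuity of the t-norm and finite covers of
the interval. Second, a map into a power of `alphaR` is continuous for the Scott structure as soon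
as its coordinates are closed functions (`isContinuous_power_alphaR`), by an ultrafilter and
compactness argument. Together they make powers injective, and injectivity passes to retracts. Since
Scott continuous maps are continuous between Scott structures, this is one implication.

Conversely, the distances to all subsets embed a separated space in a power, and injectivity yields
a continuous retraction. Closed functions of a Scott structure are Scott closed
(`isScottClosed_of_isClosedFun`), so the retraction is Scott continuous; `isScottClosed_of_retract`
then gives the same property for the space itself. Hence the embedding is Scott continuous too, and
the given structure is the Scott one. -/

/-- The weight `⨆ i, ⨅ j ≥ i, X(-, x j)` of a net `x`. -/
def netWeight (α : QOrder T X) {J : Type w} [Preorder J] (x : J → X) (y : X) : I :=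
  ⨆ i, ⨅ (j) (_ : i ≤ j), α.hom y (x j)

theorem isWeight_netWeight (α : QOrder T X) {J : Type w} [Preorder J] (x : J → X) :
    α.IsWeight (α.netWeight x) := by
  intro y z
  rw [T.op_comm, ← T.le_imp]
  refine iSup_le fun i => T.le_imp.2 (le_trans ?_ (le_iSup _ i))
  refine le_iInf₂ fun j hj => ?_
  rw [T.op_comm]
  exact (T.op_mono (iInf₂_le j hj) le_rfl).trans (α.hom_trans y z (x j))

theorem tail_le_netWeight (α : QOrder T X) {J : Type w} [Preorder J] (x : J → X) {i j : J}
    (hij : i ≤ j) :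
    ⨅ (j) (m) (_ : i ≤ j) (_ : j ≤ m), α.hom (x j) (x m) ≤ α.netWeight x (x j) := by
  refine le_trans ?_ (le_iSup _ j)
  refine le_iInf₂ fun m hjm => ?_
  exact (iInf₂_le j m).trans (iInf₂_le hij hjm)

/-- A weight converges along a forward Cauchy net to its `sub` from the weight of the net. -/
theorem tendsto_sub_netWeight {α : QOrder T X} {J : Type w} [Preorder J] [IsDirected J (· ≤ ·)]
    [Nonempty J] {x : J → X} (hx : α.IsForwardCauchyNet x) {φ : X → I} (hφ : α.IsWeight φ) :
    Tendsto (fun j => φ (x j)) atTop (𝓝 (sub T (α.netWeight x) φ)) := by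
  set p := sub T (α.netWeight x) φ with hp
  refine tendsto_order.2 ⟨fun c hc => ?_, fun c hc => ?_⟩
  -- Tails have supremum 1, so `p` combined with some tail still exceeds `c`.
  · have h : ∃ i, c < T.op p (⨅ (j) (m) (_ : i ≤ j) (_ : j ≤ m), α.hom (x j) (x m)) := by
      by_contra! h
      refine hc.not_ge ?_
      rw [← T.one_le_imp, ← hx]
      exact iSup_le fun i => T.le_imp.2 (h i)
    obtain ⟨i, hi⟩ := h
    filter_upwards [eventually_ge_atTop i] with j hj
    refine hi.trans_le ((T.op_mono le_rfl (α.tail_le_netWeight x hj)).trans ?_)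
    rw [T.op_comm]
    exact le_sub.1 hp.le (x j)
  -- Values at least `c` along a cofinal set already force `c ≤ p`; the Cauchy condition is not
  -- needed here.
  · by_contra h
    refine hc.not_ge (le_sub.2 fun y => ?_)
    rw [T.op_comm, ← T.le_imp]
    refine iSup_le fun k => ?_
    obtain ⟨j, hkj, hj⟩ := frequently_atTop.1 (not_eventually.1 h) k
    exact (iInf₂_le j hkj).trans
      (T.le_imp.2 ((T.op_mono (not_lt.1 hj) le_rfl).trans (hφ y (x j))))

theorem IsForwardCauchyNet.map {α : QOrder T X} {β : QOrder T Y} {f : X → Y}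
    (hf : α.IsOrderPreserving β f) {J : Type w} [Preorder J] {x : J → X}
    (hx : α.IsForwardCauchyNet x) : β.IsForwardCauchyNet (f ∘ x) := by
  refine le_antisymm unitInterval.le_one' (hx.ge.trans ?_)
  exact iSup_mono fun i => iInf₂_mono fun j m => iInf₂_mono fun _ _ => hf _ _

theorem IsForwardCauchyNet.isForwardCauchyWeight {α : QOrder T X} {J : Type u} [Preorder J]
    [IsDirected J (· ≤ ·)] [Nonempty J] {x : J → X} (hx : α.IsForwardCauchyNet x) :
    α.IsForwardCauchyWeight (α.netWeight x) :=
  ⟨α.isWeight_netWeight x, J, inferInstance, inferInstance, inferInstance, x, hx, fun _ => rfl⟩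

theorem image_netWeight {α : QOrder T X} {β : QOrder T Y} {f : X → Y}
    (hf : α.IsOrderPreserving β f) {J : Type w} [Preorder J] [IsDirected J (· ≤ ·)] {x : J → X}
    (hx : α.IsForwardCauchyNet x) :
    β.image f (α.netWeight x) = β.netWeight (f ∘ x) := by
  funext y
  refine le_antisymm (iSup_le fun z => ?_) (iSup_le fun k => ?_)
  · rw [T.op_comm, ← T.le_imp]
    refine iSup_le fun i => T.le_imp.2 (le_trans ?_ (le_iSup _ i))
    refine le_iInf₂ fun j hj => ?_
    rw [T.op_comm]
    exact (T.op_mono ((iInf₂_le j hj).trans (hf _ _)) le_rfl).trans (β.hom_trans y (f z) (f (x j)))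
  -- Replacing 1 by the supremum of the tails allows a late `x j` to serve as witness: it belongs to
  -- the weight of the net almost to degree 1.
  · rw [← T.one_le_imp, ← hx]
    refine iSup_le fun i => T.le_imp.2 ?_
    obtain ⟨j, hkj, hij⟩ := exists_ge_ge k i
    refine le_trans ?_ (le_iSup _ (x j))
    rw [T.op_comm]
    exact T.op_mono (α.tail_le_netWeight x hij) (iInf₂_le j hkj)

theorem IsForwardCauchyWeight.exists_net {α : QOrder T X} {l : X → I}
    (hl : α.IsForwardCauchyWeight l) :
    ∃ (J : Type u) (_ : Preorder J) (_ : IsDirected J (· ≤ ·)) (_ : Nonempty J) (x : J → X),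
      α.IsForwardCauchyNet x ∧ l = α.netWeight x := by
  obtain ⟨-, J, h₁, h₂, h₃, x, hx, h⟩ := hl
  exact ⟨J, h₁, h₂, h₃, x, hx, funext h⟩

theorem IsForwardCauchyWeight.image {Y : Type u} {α : QOrder T X} {β : QOrder T Y} {f : X → Y}
    (hf : α.IsOrderPreserving β f) {l : X → I} (hl : α.IsForwardCauchyWeight l) :
    β.IsForwardCauchyWeight (β.image f l) := by
  obtain ⟨J, _, _, _, x, hx, rfl⟩ := hl.exists_net
  rw [image_netWeight hf hx]
  exact (hx.map hf).isForwardCauchyWeight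

/-- Extends `sub_image` from the representable weights to all weights, which is what pulling back
Scott closedness requires. -/
theorem sub_image_weight {β : QOrder T Y} (f : X → Y) (l : X → I) {φ : Y → I}
    (hφ : β.IsWeight φ) : sub T (β.image f l) φ = sub T l (φ ∘ f) := by
  refine eq_of_forall_le_iff fun c => ?_
  rw [le_sub, le_sub]
  constructor
  · intro h x
    refine le_trans (T.op_mono ?_ le_rfl) (h (f x))
    refine le_trans ?_ (le_iSup _ x)
    conv_lhs => rw [← T.op_one (l x)]
    exact T.op_mono le_rfl (β.one_le_hom _)
  · intro h y
    rw [T.op_comm, ← T.le_imp]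
    refine iSup_le fun x => ?_
    rw [T.le_imp, T.op_comm, T.op_comm (l x), T.op_assoc, T.op_comm]
    exact (T.op_mono (h x) le_rfl).trans (hφ y (f x))

theorem IsScottClosed.comp {Y : Type u} {α : QOrder T X} {β : QOrder T Y} {f : X → Y} {φ : Y → I}
    (hφ : β.IsScottClosed φ) (hf : α.IsScottContinuous β f) : α.IsScottClosed (φ ∘ f) := by
  obtain ⟨hw, hφ⟩ := isScottClosed_iff.1 hφ
  refine isScottClosed_iff.2 ⟨fun x y => ?_, fun l hl a ha => ?_⟩
  · exact (T.op_mono le_rfl (hf.1 x y)).trans (hw _ _)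
  · rw [← sub_image_weight f l hw]
    exact hφ _ (hl.image hf.1) _ (hf.2 l hl a ha)

theorem isScottClosed_hom (α : QOrder T X) (y : X) : α.IsScottClosed fun x => α.hom x y :=
  isScottClosed_iff.2 ⟨fun x z => α.hom_trans x z y, fun _ _ _ ha => ha y⟩

/-! ### The Scott approach structure -/

theorem le_scottApproach {α : QOrder T X} {c : I} {x : X} {A : Set X} :
    c ≤ α.scottApproach.dist x A ↔
      ∀ φ, α.IsScottClosed φ → (∀ a ∈ A, 1 ≤ φ a) → c ≤ φ x := by
  change c ≤ sInf {φ | φ ∈ α.scottCotopology.closed ∧ Cotopology.one A ≤ φ} x ↔ _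
  rw [sInf_apply, le_iInf_iff]
  constructor
  · exact fun h φ hφ hA => h ⟨φ, hφ, Cotopology.one_le_iff.2 hA⟩
  · exact fun h φ => h φ.1 φ.2.1 (Cotopology.one_le_iff.1 φ.2.2)

theorem scottApproach_le {α : QOrder T X} {φ : X → I} (hφ : α.IsScottClosed φ) {A : Set X}
    (hA : ∀ a ∈ A, 1 ≤ φ a) (x : X) : α.scottApproach.dist x A ≤ φ x :=
  le_scottApproach.1 le_rfl φ hφ hA

/-- The representable weight at `y` is Scott closed, and it is the least weight with value 1 at `y`.
-/
theorem specialization_scottApproach (α : QOrder T X) : α.scottApproach.specialization = α := by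
  ext x y : 3
  refine le_antisymm ?_ (le_scottApproach.2 fun φ hφ hy => ?_)
  · refine scottApproach_le (α.isScottClosed_hom y) ?_ x
    rintro _ rfl
    exact α.one_le_hom _
  · rw [← T.one_op (α.hom x y)]
    exact (T.op_mono (hy y rfl) le_rfl).trans ((isScottClosed_iff.1 hφ).1 x y)

theorem IsScottContinuous.isContinuous {Y : Type u} {α : QOrder T X} {β : QOrder T Y} {f : X → Y}
    (hf : α.IsScottContinuous β f) : α.scottApproach.IsContinuous β.scottApproach f := by
  intro x A
  refine le_scottApproach.2 fun φ hφ hA => ?_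
  exact scottApproach_le (hφ.comp hf) (fun a ha => hA _ ⟨a, ha, rfl⟩) x

end QOrder

/-! ### Closed functions on an approach space and their extension. -/

namespace ApproachStructure

variable {T : ContinuousTNorm} {X : Type u} {Y : Type v} {Z : Type w}

theorem IsContinuous.comp {δ : ApproachStructure T X} {ε : ApproachStructure T Y}
    {η : ApproachStructure T Z} {g : Y → Z} {f : X → Y} (hg : ε.IsContinuous η g)
    (hf : δ.IsContinuous ε f) : δ.IsContinuous η (g ∘ f) := by
  intro x A
  rw [Set.image_comp]
  exact (hf x A).trans (hg _ _)

/-- `φ` is a continuous map to the approach space `[0,1]` with structure `(x, A) ↦ ⨅ A → x`. -/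
def IsClosedFun (δ : ApproachStructure T X) (φ : X → I) : Prop :=
  ∀ x A, T.op (⨅ a ∈ A, φ a) (δ.dist x A) ≤ φ x

theorem isClosedFun_dist (δ : ApproachStructure T X) (A : Set X) :
    δ.IsClosedFun fun x => δ.dist x A := fun x B => δ.le_dist x A B

theorem IsClosedFun.comp {δ : ApproachStructure T X} {ε : ApproachStructure T Y} {f : X → Y}
    {φ : Y → I} (hφ : ε.IsClosedFun φ) (hf : δ.IsContinuous ε f) : δ.IsClosedFun (φ ∘ f) := by
  intro x A
  refine le_trans (T.op_mono ?_ (hf x A)) (hφ (f x) (f '' A))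
  rw [iInf_image]
  exact le_rfl

theorem IsClosedFun.isWeight {δ : ApproachStructure T X} {φ : X → I} (hφ : δ.IsClosedFun φ) :
    δ.specialization.IsWeight φ := by
  intro x y
  have h := hφ x {y}
  rwa [iInf_singleton] at h

theorem dist_mono (δ : ApproachStructure T X) (x : X) {A B : Set X} (h : A ⊆ B) :
    δ.dist x A ≤ δ.dist x B := by
  rw [← Set.union_eq_self_of_subset_left h, δ.dist_union]
  exact le_sup_left

theorem one_le_dist_of_mem (δ : ApproachStructure T X) {x : X} {A : Set X} (h : x ∈ A) :
    1 ≤ δ.dist x A :=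
  (δ.one_le_dist x).trans (δ.dist_mono x (Set.singleton_subset_iff.2 h))

/-- Split `A` according to which function is larger; the distance to a union is the maximum of the
two distances. -/
theorem IsClosedFun.sup {δ : ApproachStructure T X} {φ ψ : X → I} (hφ : δ.IsClosedFun φ)
    (hψ : δ.IsClosedFun ψ) : δ.IsClosedFun (φ ⊔ ψ) := by
  intro x A
  have hA : A = {a ∈ A | ψ a ≤ φ a} ∪ {a ∈ A | φ a ≤ ψ a} := by
    ext a
    have := le_total (ψ a) (φ a)
    simp only [Set.mem_union, Set.mem_ofPred_eq]
    tauto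
  have h₁ : T.op (⨅ a ∈ A, (φ ⊔ ψ) a) (δ.dist x {a ∈ A | ψ a ≤ φ a}) ≤ φ x := by
    refine le_trans (T.op_mono (le_iInf₂ fun a ha => ?_) le_rfl) (hφ x _)
    exact (iInf₂_le a ha.1).trans (sup_le le_rfl ha.2)
  have h₂ : T.op (⨅ a ∈ A, (φ ⊔ ψ) a) (δ.dist x {a ∈ A | φ a ≤ ψ a}) ≤ ψ x := by
    refine le_trans (T.op_mono (le_iInf₂ fun a ha => ?_) le_rfl) (hψ x _)
    exact (iInf₂_le a ha.1).trans (sup_le ha.2 le_rfl)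
  rw [← T.le_imp] at h₁ h₂ ⊢
  conv_lhs => rw [hA]
  rw [δ.dist_union]
  exact sup_le (h₁.trans (T.imp_mono le_rfl le_sup_left))
    (h₂.trans (T.imp_mono le_rfl le_sup_right))

theorem isClosedFun_zero (δ : ApproachStructure T X) : δ.IsClosedFun fun _ => 0 := by
  intro x A
  rcases A.eq_empty_or_nonempty with rfl | ⟨a, ha⟩
  · rw [δ.dist_empty, T.op_comm]
    exact T.op_le_left _ _
  · exact (T.op_le_left _ _).trans (iInf₂_le a ha)

theorem IsClosedFun.iInf {δ : ApproachStructure T X} {κ : Sort*} {φ : κ → X → I}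
    (h : ∀ k, δ.IsClosedFun (φ k)) : δ.IsClosedFun fun x => ⨅ k, φ k x := by
  intro x A
  refine le_iInf fun k => le_trans (T.op_mono ?_ le_rfl) (h k x A)
  exact le_iInf₂ fun a ha => (iInf₂_le a ha).trans (iInf_le _ k)

/-- By continuity of the t-norm, `T.op q` commutes with infima of nonempty sets. The empty set is
treated apart because its infimum is 1. -/
theorem IsClosedFun.op {δ : ApproachStructure T X} {φ : X → I} (hφ : δ.IsClosedFun φ) (q : I) :
    δ.IsClosedFun fun x => T.op q (φ x) := by
  intro x A
  rcases A.eq_empty_or_nonempty with rfl | hA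
  · rw [δ.dist_empty, T.op_comm]
    exact (T.op_le_left _ _).trans (T.op q (φ x)).2.1
  have hc : Continuous (T.op q) := T.continuous_op.comp (by fun_prop : Continuous fun b => (q, b))
  have hm : Monotone (T.op q) := fun a b h => T.op_mono le_rfl h
  have h : ⨅ a ∈ A, T.op q (φ a) = T.op q (⨅ a ∈ A, φ a) := by
    have := Monotone.map_csInf_of_continuousAt (A := φ '' A) hc.continuousAt hm (hA.image _)
    rw [sInf_image, ← Set.image_comp, sInf_image] at this
    exact this.symm
  rw [h, T.op_assoc]
  exact T.op_mono le_rfl (hφ x A)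

theorem IsClosedFun.finset_sup {δ : ApproachStructure T X} {κ : Type*} (t : Finset κ)
    {φ : κ → X → I} (h : ∀ k ∈ t, δ.IsClosedFun (φ k)) :
    δ.IsClosedFun (t.sup φ) := by
  classical
  induction t using Finset.induction_on with
  | empty => exact δ.isClosedFun_zero
  | insert k t _ ih =>
    rw [Finset.sup_insert]
    exact (h k (by simp)).sup (ih fun k hk => h k (by simp [hk]))

/-- A closed function on a subspace is, up to arbitrarily small error at a point, dominated by a
closed function on the whole space. -/
theorem exists_isClosedFun_lt (δ : ApproachStructure T X) {S : Set X} {f : S → I}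
    (hf : (δ.subspace S).IsClosedFun f) (s : S) {c : I} (hc : f s < c) :
    ∃ φ, δ.IsClosedFun φ ∧ (∀ y : S, f y ≤ φ y) ∧ φ s ≤ c := by
  -- Choose `r` so that moving one argument of the t-norm by less than `r` moves its value by less
  -- than `c - f s`. Balls of radius `r / 3` then have small enough oscillation.
  have huc := CompactSpace.uniformContinuous_of_continuous T.continuous_op
  obtain ⟨r, hr, h⟩ := Metric.uniformContinuous_iff.1 huc (c - f s : ℝ) (sub_pos.2 hc)
  obtain ⟨t, -, ht⟩ := isCompact_univ.elim_finite_subcover_image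
    (b := (Set.univ : Set I)) (c := fun p => Metric.ball p (r / 3))
    (fun _ _ => Metric.isOpen_ball) (fun p _ => Set.mem_iUnion₂.2 ⟨p, trivial, by simp [hr]⟩)
  obtain ⟨ht, hcov⟩ := ht
  lift t to Finset I using ht
  -- On `B p` the values of `f` lie in one ball, with supremum `q p`. The maximum of the functions
  -- `q p & δ(-, B p)` dominates `f`. With the infimum of the ball in place of `q p`, closedness of
  -- `f` bounds each term at `s` by `f s`; the exchange costs less than `c - f s`.
  let q : I → I := fun p => sSup (Metric.ball p (r / 3))
  let B : I → Set X := fun p => Subtype.val '' (f ⁻¹' Metric.ball p (r / 3))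
  refine ⟨t.sup fun p x => T.op (q p) (δ.dist x (B p)),
    IsClosedFun.finset_sup t fun p _ => (δ.isClosedFun_dist _).op _, fun y => ?_, ?_⟩
  · obtain ⟨p, hp, hy⟩ := Set.mem_iUnion₂.1 (hcov (Set.mem_univ (f y)))
    rw [Finset.sup_apply]
    refine le_trans ?_ (Finset.le_sup (f := fun p => T.op (q p) (δ.dist y (B p))) hp)
    refine (le_sSup hy).trans ?_
    conv_lhs => rw [← T.op_one (sSup _)]
    exact T.op_mono le_rfl (δ.one_le_dist_of_mem ⟨y, hy, rfl⟩)
  · rw [Finset.sup_apply]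
    refine Finset.sup_le fun p _ => ?_
    have h₁ : T.op (sInf (Metric.ball p (r / 3))) (δ.dist s (B p)) ≤ f s := by
      refine le_trans (T.op_mono ?_ le_rfl) (hf s (f ⁻¹' Metric.ball p (r / 3)))
      exact le_iInf₂ fun a ha => sInf_le ha
    have hp : p ∈ Metric.ball p (r / 3) := by simp [hr]
    have hsup : (q p : ℝ) ≤ p + r / 3 := by
      by_contra! hlt
      have hp1 : (p : ℝ) + r / 3 < 1 := hlt.trans_le (q p).2.2
      have : q p ≤ ⟨p + r / 3, by have := p.2.1; positivity, hp1.le⟩ := by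
        refine sSup_le fun b hb => ?_
        rw [Metric.mem_ball, Subtype.dist_eq, Real.dist_eq, abs_lt] at hb
        exact Subtype.mk_le_mk.2 (by linarith)
      exact absurd (Subtype.coe_le_coe.2 this) (not_le.2 hlt)
    have hinf : (p : ℝ) - r / 3 ≤ (sInf (Metric.ball p (r / 3)) : I) := by
      by_contra! hlt
      have hp1 : (0 : ℝ) < p - r / 3 := lt_of_le_of_lt (sInf (Metric.ball p (r / 3))).2.1 hlt
      have : ⟨p - r / 3, hp1.le, by have := p.2.2; linarith⟩ ≤ sInf (Metric.ball p (r / 3)) := by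
        refine le_sInf fun b hb => ?_
        rw [Metric.mem_ball, Subtype.dist_eq, Real.dist_eq, abs_lt] at hb
        exact Subtype.mk_le_mk.2 (by linarith)
      exact absurd (Subtype.coe_le_coe.2 this) (not_le.2 hlt)
    have hle : (sInf (Metric.ball p (r / 3)) : I) ≤ q p := (sInf_le hp).trans (le_sSup hp)
    have hle' : ((sInf (Metric.ball p (r / 3)) : I) : ℝ) ≤ q p := hle
    have hd := h (a := (q p, δ.dist s (B p)))
      (b := (sInf (Metric.ball p (r / 3)), δ.dist s (B p))) (by
        rw [Prod.dist_eq, dist_self, max_eq_left dist_nonneg, Subtype.dist_eq, Real.dist_eq,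
          abs_of_nonneg (by linarith)]
        linarith)
    rw [Subtype.dist_eq, Real.dist_eq] at hd
    have hd' := (abs_lt.1 hd).2
    have h₂ : (T.op (sInf (Metric.ball p (r / 3))) (δ.dist s (B p)) : ℝ) ≤ f s := h₁
    exact Subtype.coe_le_coe.1 (by linarith)

/-- Closed functions extend from subspaces. -/
theorem IsClosedFun.exists_extension {δ : ApproachStructure T X} {S : Set X} {f : S → I}
    (hf : (δ.subspace S).IsClosedFun f) : ∃ g, δ.IsClosedFun g ∧ ∀ y : S, g y = f y := by
  -- The extension is the least closed function dominating `f` on `S`.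
  refine ⟨fun x => ⨅ φ : {φ : X → I // δ.IsClosedFun φ ∧ ∀ y : S, f y ≤ φ y}, φ.1 x,
    IsClosedFun.iInf fun φ => φ.2.1, fun y => le_antisymm ?_ (le_iInf fun φ => φ.2.2 y)⟩
  refine le_of_forall_gt_imp_ge_of_dense fun c hc => ?_
  obtain ⟨φ, h₁, h₂, h₃⟩ := δ.exists_isClosedFun_lt hf y hc
  exact (iInf_le _ ⟨φ, h₁, h₂⟩).trans h₃

/-- The distance from a point to a set is attained by an ultrafilter on the set. -/
theorem exists_ultrafilter (δ : ApproachStructure T X) (x : X) {A : Set X}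
    (hA : 0 < δ.dist x A) :
    ∃ U : Ultrafilter X, A ∈ U ∧ ∀ B ∈ U, δ.dist x A ≤ δ.dist x B := by
  -- Sets whose complement is strictly farther from `x` than `A`, in the sense of a smaller degree.
  -- Since `A` is not such a complement, `F` is compatible with `A`; any ultrafilter refining both
  -- works.
  let F : Filter X :=
    { sets := {B | δ.dist x Bᶜ < δ.dist x A}
      univ_sets := by simpa [δ.dist_empty] using hA
      sets_of_superset := fun h h' =>
        (δ.dist_mono x (Set.compl_subset_compl.2 h')).trans_lt h
      inter_sets := fun {B C} h h' => by
        change δ.dist x (B ∩ C)ᶜ < _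
        rw [Set.compl_inter, δ.dist_union]
        exact sup_lt_iff.2 ⟨h, h'⟩ }
  have hne : (F ⊓ 𝓟 A).NeBot := by
    rw [Filter.neBot_iff, Ne, ← Filter.empty_mem_iff_bot, Filter.mem_inf_principal]
    intro h
    change δ.dist x {y | y ∈ A → y ∈ (∅ : Set X)}ᶜ < _ at h
    have : {y | y ∈ A → y ∈ (∅ : Set X)}ᶜ = A := by ext; simp
    rw [this] at h
    exact lt_irrefl _ h
  refine ⟨Ultrafilter.of (F ⊓ 𝓟 A), ?_, fun B hB => ?_⟩
  · exact Ultrafilter.of_le _ (Filter.mem_inf_of_right (Filter.mem_principal_self A))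
  · by_contra! h
    have hBc : Bᶜ ∈ F := by
      change δ.dist x Bᶜᶜ < _
      rwa [compl_compl]
    exact Ultrafilter.compl_notMem_iff.2 hB
      (Ultrafilter.of_le _ (Filter.mem_inf_of_left hBc))

end ApproachStructure

/-! ### Closed functions of a Scott approach structure. -/

namespace QOrder

variable {T : ContinuousTNorm} {X : Type u} {Y : Type v}

/-- With `p` the infimum of `φ` on `A`, the weight `p → φ` is Scott closed and equals 1 on `A`, so
it bounds the distance to `A`. -/
theorem IsScottClosed.isClosedFun {α : QOrder T X} {φ : X → I} (hφ : α.IsScottClosed φ) :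
    α.scottApproach.IsClosedFun φ := by
  intro x A
  rw [← T.le_imp]
  refine scottApproach_le (α.scottCotopology.imp_mem _ φ hφ) (fun a ha => ?_) x
  exact T.one_le_imp.2 (iInf₂_le a ha)

/-- The closed functions of a Scott approach space are Scott closed weights. -/
theorem isScottClosed_of_isClosedFun {α : QOrder T X} {φ : X → I}
    (hφ : α.scottApproach.IsClosedFun φ) : α.IsScottClosed φ := by
  have hw : α.IsWeight φ := by
    have := hφ.isWeight
    rwa [specialization_scottApproach] at this
  refine isScottClosed_iff.2 ⟨hw, fun l hl a ha => le_antisymm ?_ ?_⟩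
  · have h := (α.one_le_hom a).trans_eq (ha a)
    refine le_sub.2 fun x => ?_
    have hx := le_sub.1 h x
    rw [T.op_one] at hx
    rw [T.op_comm]
    exact (T.op_mono le_rfl hx).trans (hw x a)
  · obtain ⟨J, _, _, _, x, hx, rfl⟩ := hl.exists_net
    refine le_of_forall_lt_imp_le_of_dense fun c hc => ?_
    obtain ⟨k, hk⟩ := eventually_atTop.1 ((tendsto_sub_netWeight hx hw).eventually_const_lt hc)
    -- A supremum has distance degree 1 to every tail of the net: a Scott closed weight equal to 1
    -- on a tail has limit 1, and that limit is its value at `a`.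
    refine le_trans ?_ (hφ a (x '' Set.Ici k))
    rw [← T.op_one c]
    refine T.op_mono ?_ (le_scottApproach.2 fun ψ hψ h => ?_)
    · rw [iInf_image]
      exact le_iInf₂ fun j hj => (hk j hj).le
    · obtain ⟨hψw, hψ⟩ := isScottClosed_iff.1 hψ
      rw [hψ _ hl a ha]
      refine ge_of_tendsto (tendsto_sub_netWeight hx hψw) ?_
      filter_upwards [eventually_ge_atTop k] with j hj
      exact h _ ⟨j, hj, rfl⟩

theorem IsSup.unique {α : QOrder T X} (hα : α.IsSeparated) {l : X → I} {a b : X}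
    (ha : α.IsSup l a) (hb : α.IsSup l b) : a = b := by
  refine hα a b (le_inf ?_ ?_)
  · rw [ha b, ← hb b]
    exact α.one_le_hom b
  · rw [hb a, ← ha a]
    exact α.one_le_hom a

/-! ### Powers of `([0,1], α_R)` -/

theorem power_alphaR_isSeparated (ι : Type v) : ((alphaR T).power ι).IsSeparated := by
  intro x y h
  obtain ⟨h₁, h₂⟩ := le_inf_iff.1 h
  funext i
  exact le_antisymm (T.one_le_imp.1 (le_iInf_iff.1 h₂ i)) (T.one_le_imp.1 (le_iInf_iff.1 h₁ i))

theorem one_le_hom_power_alphaR {ι : Type v} {x y : ι → I} (h : y ≤ x) :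
    1 ≤ ((alphaR T).power ι).hom x y :=
  le_iInf fun i => T.one_le_imp.2 (h i)

/-- Suprema of weights in a power of `([0,1], α_R)` exist and are computed coordinatewise. -/
theorem isSup_power_alphaR {ι : Type v} (l : (ι → I) → I) :
    ((alphaR T).power ι).IsSup l fun i => sub T l fun x => x i := by
  intro y
  refine eq_of_forall_le_iff fun c => ?_
  rw [le_sub]
  change c ≤ ⨅ i, T.imp (y i) (sub T l fun x : ι → I => x i) ↔
    ∀ x : ι → I, _ ≤ ⨅ i, T.imp (y i) (x i)
  simp only [le_iInf_iff, T.le_imp, le_sub]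
  rw [forall_comm]
  refine forall₂_congr fun x i => ?_
  rw [← T.op_assoc, ← T.op_assoc, T.op_comm (y i)]

theorem isScottClosed_proj {ι : Type v} (i : ι) :
    ((alphaR T).power ι).IsScottClosed fun x : ι → I => x i := by
  refine isScottClosed_iff.2 ⟨fun x y => ?_, fun l _ a ha => ?_⟩
  · exact T.le_imp.1 (iInf_le _ i)
  · rw [ha.unique (power_alphaR_isSeparated ι) (isSup_power_alphaR l)]

/-- The upper level sets of a Scott closed weight of a power of `([0,1], α_R)` are closed in the
product topology. -/
theorem IsScottClosed.le_of_mem_closure {ι : Type v} {ψ : (ι → I) → I}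
    (hψ : ((alphaR T).power ι).IsScottClosed ψ) {p : I} {A : Set (ι → I)}
    (hA : ∀ a ∈ A, p ≤ ψ a) {t : ι → I} (ht : t ∈ closure A) : p ≤ ψ t := by
  obtain ⟨hw, hψ⟩ := isScottClosed_iff.1 hψ
  have hmono : ∀ {x y : ι → I}, y ≤ x → ψ y ≤ ψ x := fun {x y} h => by
    rw [← T.op_one (ψ y)]
    exact (T.op_mono le_rfl (one_le_hom_power_alphaR h)).trans (hw x y)
  -- Smaller neighbourhoods come later. The points `sSup (V ∩ A)` decrease coordinatewise, hence
  -- increase in `α_R`, so they form a Cauchy net. Its supremum lies coordinatewise below `t`, and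
  -- `ψ` is at least `p` along it.
  let J := {V : Set (ι → I) // V ∈ 𝓝 t}ᵒᵈ
  have : IsDirected J (· ≤ ·) :=
    ⟨fun V W => ⟨⟨V.1 ∩ W.1, inter_mem V.2 W.2⟩, Set.inter_subset_left, Set.inter_subset_right⟩⟩
  have : Nonempty J := ⟨⟨Set.univ, univ_mem⟩⟩
  let x : J → ι → I := fun V => sSup (V.1 ∩ A)
  have hxanti : ∀ j m : J, j ≤ m → x m ≤ x j := fun j m h =>
    sSup_le_sSup (Set.inter_subset_inter_left A h)
  have hx : ((alphaR T).power ι).IsForwardCauchyNet x := by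
    refine le_antisymm unitInterval.le_one' (le_trans ?_ (le_iSup _ (Classical.arbitrary J)))
    exact le_iInf₂ fun j m => le_iInf₂ fun _ h => one_le_hom_power_alphaR (hxanti j m h)
  refine le_trans ?_ (hmono (y := fun i => sub T (((alphaR T).power ι).netWeight x) fun y => y i)
    fun i => ?_)
  · rw [hψ _ hx.isForwardCauchyWeight _ (isSup_power_alphaR _)]
    refine ge_of_tendsto (tendsto_sub_netWeight hx hw) (Eventually.of_forall fun V => ?_)
    obtain ⟨a, haV, haA⟩ := mem_closure_iff_nhds.1 ht V.1 V.2
    exact (hA a haA).trans (hmono (le_sSup ⟨haV, haA⟩))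
  · have hlim := tendsto_sub_netWeight hx
      (isScottClosed_iff.1 (isScottClosed_proj (T := T) i)).1
    refine le_of_forall_gt_imp_ge_of_dense fun c hc => le_of_tendsto hlim ?_
    have hV : {y : ι → I | y i < c} ∈ 𝓝 t :=
      (continuous_apply i).continuousAt.eventually_lt_const hc
    filter_upwards [eventually_ge_atTop (OrderDual.toDual ⟨_, hV⟩ : J)] with W hW
    change sSup (W.1 ∩ A) i ≤ c
    rw [sSup_apply]
    exact iSup_le fun y => le_of_lt (hW y.2.1)

/-- Scott closed weights of a power of `([0,1], α_R)` are generated by the projections. -/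
theorem IsScottClosed.isClosedFun_comp {δ : ApproachStructure T X} {ι : Type v} {s : X → ι → I}
    (hs : ∀ i, δ.IsClosedFun fun x => s x i) {ψ : (ι → I) → I}
    (hψ : ((alphaR T).power ι).IsScottClosed ψ) : δ.IsClosedFun (ψ ∘ s) := by
  intro x A
  -- The ultrafilter exists only for positive distance degree.
  rcases (bot_le : (0 : I) ≤ δ.dist x A).eq_or_lt with h0 | hpos
  · rw [← h0, T.op_comm]
    exact (T.op_le_left _ _).trans (ψ (s x)).2.1
  obtain ⟨U, hAU, hU⟩ := δ.exists_ultrafilter x hpos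
  obtain ⟨t, -, ht⟩ := isCompact_univ.ultrafilter_le_nhds (U.map s) (by simp)
  have hlim : Tendsto s U (𝓝 t) := ht
  have h₁ : ⨅ a ∈ A, (ψ ∘ s) a ≤ ψ t := by
    refine hψ.le_of_mem_closure (A := s '' A) ?_ (mem_closure_of_tendsto hlim ?_)
    · rintro _ ⟨a, ha, rfl⟩
      exact iInf₂_le a ha
    · filter_upwards [hAU] with a ha using ⟨a, ha, rfl⟩
  -- For `c < t i`, the set where the coordinate exceeds `c` belongs to `U`, so its distance degree
  -- is at least that of `A`; closedness of the coordinate then gives the bound.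
  have h₂ : δ.dist x A ≤ ((alphaR T).power ι).hom (s x) t := by
    refine le_iInf fun i => T.le_imp.2 ?_
    rw [T.op_comm, ← T.le_imp]
    refine le_of_forall_lt_imp_le_of_dense fun c hc => T.le_imp.2 ?_
    have hB : {y | c < s y i} ∈ U := (tendsto_pi_nhds.1 hlim i).eventually_const_lt hc
    rw [T.op_comm]
    refine le_trans (T.op_mono ?_ (hU _ hB)) (hs i x {y | c < s y i})
    exact le_iInf₂ fun a ha => le_of_lt ha
  exact (T.op_mono h₁ h₂).trans ((isScottClosed_iff.1 hψ).1 _ _)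

theorem isContinuous_power_alphaR {δ : ApproachStructure T X} {ι : Type v} {s : X → ι → I}
    (hs : ∀ i, δ.IsClosedFun fun x => s x i) :
    δ.IsContinuous ((alphaR T).power ι).scottApproach s := by
  intro x A
  refine le_scottApproach.2 fun ψ hψ h => ?_
  rw [← T.one_op (δ.dist x A)]
  refine (T.op_mono ?_ le_rfl).trans (hψ.isClosedFun_comp hs x A)
  exact le_iInf₂ fun a ha => h _ ⟨a, ha, rfl⟩

theorem power_alphaR_isInjective (ι : Type u) :
    ((alphaR T).power ι).scottApproach.IsInjective := by
  intro X δ S f hf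
  have h := fun i => ((isScottClosed_proj (T := T) i).isClosedFun.comp hf).exists_extension
  choose g hg hgf using h
  exact ⟨fun x i => g i x, isContinuous_power_alphaR hg, fun y => funext fun i => hgf i y⟩

end QOrder

/-! ### Injective spaces as retracts of powers. -/

namespace ApproachStructure

variable {T : ContinuousTNorm} {X : Type u} {Y : Type u}

theorem IsInjective.of_retract {δ : ApproachStructure T X} {ε : ApproachStructure T Y}
    (hε : ε.IsInjective) {s : X → Y} {r : Y → X} (hs : δ.IsContinuous ε s)
    (hr : ε.IsContinuous δ r) (hrs : ∀ x, r (s x) = x) : δ.IsInjective := by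
  intro W η S f hf
  obtain ⟨g, hg, hgf⟩ := hε W η S (s ∘ f) (hs.comp hf)
  refine ⟨r ∘ g, hr.comp hg, fun y => ?_⟩
  rw [Function.comp_apply, hgf, Function.comp_apply, hrs]

/-- Continuous maps are Scott continuous if all closed functions on the domain are Scott closed. -/
theorem IsContinuous.isScottContinuous {δ : ApproachStructure T X} {ε : ApproachStructure T Y}
    (hδ : ∀ φ, δ.IsClosedFun φ → δ.specialization.IsScottClosed φ) {f : X → Y}
    (hf : δ.IsContinuous ε f) : δ.specialization.IsScottContinuous ε.specialization f := by
  refine ⟨fun x y => ?_, fun l hl a ha y => ?_⟩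
  · have := hf x {y}
    rwa [Set.image_singleton] at this
  · rw [QOrder.sub_image]
    exact (QOrder.isScottClosed_iff.1 (hδ _ ((ε.isClosedFun_dist {y}).comp hf))).2 l hl a ha

/-- A separated space embeds in a power of `[0,1]` by its distances to subsets. -/
theorem isContinuous_dist (δ : ApproachStructure T X) :
    δ.IsContinuous ((QOrder.alphaR T).power (Set X)).scottApproach δ.dist :=
  QOrder.isContinuous_power_alphaR δ.isClosedFun_dist

/-- The projection at coordinate `A` is Scott closed and equals 1 on the image of `A`. With
`isContinuous_dist`, this shows that `δ` is induced from the power. -/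
theorem scottApproach_dist_le (δ : ApproachStructure T X) (x : X) (A : Set X) :
    ((QOrder.alphaR T).power (Set X)).scottApproach.dist (δ.dist x) (δ.dist '' A) ≤
      δ.dist x A := by
  refine QOrder.scottApproach_le (QOrder.isScottClosed_proj A) ?_ (δ.dist x)
  rintro _ ⟨a, ha, rfl⟩
  exact δ.one_le_dist_of_mem ha

theorem IsSeparated.dist_injective {δ : ApproachStructure T X} (hδ : δ.IsSeparated) :
    Function.Injective δ.dist := by
  intro x y h
  refine hδ x y (le_inf ?_ ?_)
  · change 1 ≤ δ.dist x {y}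
    rw [h]
    exact δ.one_le_dist y
  · change 1 ≤ δ.dist y {x}
    rw [← h]
    exact δ.one_le_dist x

/-- The inverse of the embedding is continuous on its range, and injectivity extends it to the whole
power. -/
theorem IsInjective.exists_retraction {δ : ApproachStructure T X} (hδ : δ.IsSeparated)
    (h : δ.IsInjective) :
    ∃ r : (Set X → I) → X,
      ((QOrder.alphaR T).power (Set X)).scottApproach.IsContinuous δ r ∧
        ∀ x, r (δ.dist x) = x := by
  choose f hf using fun y : Set.range δ.dist => y.2
  have hfd : ∀ x, f ⟨δ.dist x, x, rfl⟩ = x := fun x => hδ.dist_injective (hf _)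
  obtain ⟨r, hr, hrf⟩ := h _ ((QOrder.alphaR T).power (Set X)).scottApproach
    (Set.range δ.dist) f (by
      intro y A
      refine le_trans ?_ (δ.scottApproach_dist_le (f y) (f '' A))
      rw [hf, ← Set.image_comp]
      have : δ.dist ∘ f = Subtype.val := funext hf
      rw [this]
      exact le_rfl)
  exact ⟨r, hr, fun x => (hrf ⟨δ.dist x, x, rfl⟩).trans (hfd x)⟩

/-- Closed functions on a separated retract of a power of `[0,1]` are Scott closed. -/
theorem isScottClosed_of_retract {δ : ApproachStructure T X} (hδ : δ.IsSeparated) {ι : Type u}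
    {s : X → ι → I} {r : (ι → I) → X}
    (hs : δ.IsContinuous ((QOrder.alphaR T).power ι).scottApproach s)
    (hr : ((QOrder.alphaR T).power ι).IsScottContinuous δ.specialization r)
    (hr' : ((QOrder.alphaR T).power ι).scottApproach.IsContinuous δ r)
    (hrs : ∀ x, r (s x) = x) {φ : X → I} (hφ : δ.IsClosedFun φ) :
    δ.specialization.IsScottClosed φ := by
  refine QOrder.isScottClosed_iff.2 ⟨hφ.isWeight, fun l hl a ha => ?_⟩
  set α := (QOrder.alphaR T).power ι
  have hso : δ.specialization.IsOrderPreserving α s := fun x y => by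
    have h := hs x {y}
    rw [Set.image_singleton] at h
    exact h.trans_eq (congrArg (fun β : QOrder T (ι → I) => β.hom (s x) (s y))
      α.specialization_scottApproach)
  have hl' := hl.image hso
  have hb := QOrder.isSup_power_alphaR (T := T) (α.image s l)
  set b : ι → I := fun i => QOrder.sub T (α.image s l) fun x => x i
  -- Only order preservation of `s` is available so far. Still, `l` can be pushed to the power,
  -- where a supremum `b` exists; `r b` is then a supremum of `l` because `r ∘ s` is the identity.
  have hab : a = r b := by
    refine ha.unique hδ fun y => ?_
    rw [hr.2 _ hl' b hb y, QOrder.sub_image,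
      QOrder.sub_image_weight s l (φ := fun x => δ.specialization.hom (r x) y)
        ((QOrder.isScottClosed_iff.1 ((δ.specialization.isScottClosed_hom y).comp hr)).1)]
    simp only [Function.comp_def, hrs]
  obtain ⟨hw, hφr⟩ :=
    QOrder.isScottClosed_iff.1 (QOrder.isScottClosed_of_isClosedFun (hφ.comp hr'))
  have h := hφr _ hl' b hb
  rw [QOrder.sub_image_weight s l hw, Function.comp_apply, ← hab] at h
  simpa only [Function.comp_def, hrs] using h

end ApproachStructure

end

theorem mainTheorem4 (T : ContinuousTNorm) {X : Type u} (δ : ApproachStructure T X)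
    (hδ : δ.IsSeparated) :
    δ.IsInjective ↔
      (∃ ι : Type u, δ.specialization.IsScottRetract ((QOrder.alphaR T).power ι)) ∧
        δ = δ.specialization.scottApproach := by
  constructor
  · intro h
    obtain ⟨r, hr, hrs⟩ := h.exists_retraction hδ
    have hr' : ((QOrder.alphaR T).power (Set X)).IsScottContinuous δ.specialization r := by
      have := hr.isScottContinuous fun φ hφ => by
        rw [QOrder.specialization_scottApproach]
        exact QOrder.isScottClosed_of_isClosedFun hφ
      rwa [QOrder.specialization_scottApproach] at this
    have hcl := fun φ (hφ : δ.IsClosedFun φ) =>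
      ApproachStructure.isScottClosed_of_retract hδ δ.isContinuous_dist hr' hr hrs hφ
    have hs := δ.isContinuous_dist.isScottContinuous hcl
    rw [QOrder.specialization_scottApproach] at hs
    refine ⟨⟨Set X, δ.dist, r, hs, hr', hrs⟩, ?_⟩
    ext x A : 3
    refine le_antisymm ?_ ?_
    -- The identity from `δ` to the Scott structure factors through the power.
    · have h₁ := (hr'.isContinuous.comp δ.isContinuous_dist) x A
      have h₂ : r ∘ δ.dist = id := funext hrs
      rwa [h₂, Set.image_id] at h₁
    · exact QOrder.scottApproach_le (hcl _ (δ.isClosedFun_dist A))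
        (fun a ha => δ.one_le_dist_of_mem ha) x
  · rintro ⟨⟨ι, s, r, hs, hr, hrs⟩, h⟩
    rw [h]
    exact (QOrder.power_alphaR_isInjective ι).of_retract hs.isContinuous hr.isContinuous hrs
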